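/- All multigraphs are finite. Let $r$ be a real number. A circular $r$-edge-colouring of a multigraph $G$ assigns to every edge $e$ a real number $c(e)\in[0,r)$ such that any two distinct edges $e,f$ with a common end satisfy $1\le |c(e)-c(f)|\le r-1$ (a multigraph with a loop has no such colouring). The circular chromatic index $\chi_c'(G)$ is the least $r$ for which $G$ admits a circular $r$-edge-colouring. The vertex connectivity of $G$ is the largest $k$ such that $G$ has more than $k$ vertices and stays connected after the deletion of any fewer than $k$ vertices; the edge connectivity of a multigraph with at least two vertices is the largest $k$ such that it stays connected after the deletion of any fewer than $k$ edges. Let $H$ be the multigraph with vertices $0,1,\dots,12$ and the $23$ edges $$05,\,16,\,16,\,07,\,27,\,57,\,08,\,38,\,48,\,58,\,19,\,39,\,49,\,69,\,\{1,10\},\,\{3,10\},\,\{4,10\},\,\{6,10\},\,\{0,11\},\,\{3,11\},\,\{4,11\},\,\{5,11\},\,\{7,12\}$$ (with two parallel edges between $1$ and $6$; here $xy$ stands for $\{x,y\}$). Its sparse6 code is `:LiAGWAJ?XApEOsPcL?XAv`. For $k\ge 2$ let $G_k$ be the multigraph obtained from $k$ disjoint copies $H_0,\dots,H_{k-1}$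 of $H$ by adding, for every $i$ modulo $k$, an edge that joins the vertex $12$ of $H_i$ to the vertex $2$ of $H_{i+1}$. **Theorem.** The vertices of degree $1$ of $H$ are exactly $2$ and $12$, and $\chi_c'(H)=19/4$. For every $k\ge 2$ the multigraph $G_k$ satisfies $\chi_c'(G_k)=4+\tfrac34$, has maximum degree $\Delta(G_k)=4$, vertex connectivity $1$ and edge connectivity $2$. The multigraphs $G_k$, $k\ge 2$, are pairwise non-isomorphic; in particular, there exist infinitely many multigraphs $G$ with $\chi_c'(G)=4+\tfrac34$, $\Delta(G)=4$, vertex connectivity $1$ and edge connectivity $2$. -/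

import Mathlib

namespace Graph

variable {α β α' β' : Type*}

/-- A multigraph given by the unordered pair of ends of each edge; every element of `α` is a
vertex and every element of `β` is an edge. -/
def ofEnds (ends : β → Sym2 α) : Graph α β where
  vertexSet := Set.univ
  IsLink e x y := ends e = s(x, y)
  isLink_symm e _ := { symm := fun x y h => by rw [h, Sym2.eq_swap] }
  eq_or_eq_of_isLink_of_isLink e x y v w h h' := by
    have h2 : s(x, y) = s(v, w) := h.symm.trans h'
    rw [Sym2.eq_iff] at h2
    tauto
  left_mem_of_isLink _ _ _ _ := Set.mem_univ _

/-- `c` is a circular `r`-edge-colouring of `G`: the colours of edges lie in `[0, r)`, `G` has no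
loop (a loop would be adjacent to itself), and any two distinct edges with a common end have
colours that differ by at least `1` and at most `r - 1`. The values of `c` outside the edge set
are irrelevant. -/
def IsCircularEdgeColouring (G : Graph α β) (r : ℝ) (c : β → ℝ) : Prop :=
  (∀ e ∈ E(G), 0 ≤ c e ∧ c e < r) ∧
  (∀ e x, ¬ G.IsLoopAt e x) ∧
  ∀ e f x, e ≠ f → G.Inc e x → G.Inc f x → 1 ≤ |c e - c f| ∧ |c e - c f| ≤ r - 1

/-- `G` has circular chromatic index `t`: the number `t` is the least real `r` for which `G` admits
a circular `r`-edge-colouring. -/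
def HasCircularChromaticIndex (G : Graph α β) (t : ℝ) : Prop :=
  IsLeast {r : ℝ | ∃ c : β → ℝ, G.IsCircularEdgeColouring r c} t

/-- The degree of a vertex; loops count twice. -/
noncomputable def degree (G : Graph α β) (x : α) : ℕ∞ :=
  {e | G.IsNonloopAt e x}.encard + 2 * {e | G.IsLoopAt e x}.encard

/-- The maximum degree. -/
noncomputable def maxDegree (G : Graph α β) : ℕ∞ :=
  ⨆ x ∈ V(G), G.degree x

/-- A graph is connected if it has a vertex and any two vertices are joined by a walk. -/
def Connected (G : Graph α β) : Prop :=
  V(G).Nonempty ∧ ∀ x ∈ V(G), ∀ y ∈ V(G), Relation.ReflTransGen G.Adj x y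

/-- `k`-connected: more than `k` vertices, and deleting fewer than `k` vertices always leaves a
connected graph. -/
def IsVertexConnected (G : Graph α β) (k : ℕ) : Prop :=
  (k : ℕ∞) < V(G).encard ∧ ∀ X ⊆ V(G), X.encard < k → (G.deleteVerts X).Connected

/-- The vertex connectivity: the largest `k` for which the graph is `k`-connected. -/
noncomputable def vertexConnectivity (G : Graph α β) : ℕ∞ :=
  ⨆ (k : ℕ) (_ : G.IsVertexConnected k), (k : ℕ∞)

/-- `k`-edge-connected: more than one vertex, and deleting fewer than `k` edges always leaves a
connected graph. -/
def IsEdgeConnected (G : Graph α β) (k : ℕ) : Prop :=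
  1 < V(G).encard ∧ ∀ F ⊆ E(G), F.encard < k → (G.deleteEdges F).Connected

/-- The edge connectivity: the largest `k` for which the graph is `k`-edge-connected. -/
noncomputable def edgeConnectivity (G : Graph α β) : ℕ∞ :=
  ⨆ (k : ℕ) (_ : G.IsEdgeConnected k), (k : ℕ∞)

/-- Two multigraphs are isomorphic if there are bijections between their vertex sets and between
their edge sets that preserve and reflect incidence. -/
def IsIsomorphic (G : Graph α β) (G' : Graph α' β') : Prop :=
  ∃ (f : V(G) ≃ V(G')) (g : E(G) ≃ E(G')), ∀ (e : E(G)) (x y : V(G)),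
    G.IsLink (e : β) (x : α) (y : α) ↔ G'.IsLink (g e : β') (f x : α') (f y : α')

/-- The circular arrangement of `k` copies of `H` (indexed by the integers modulo `k`), in which,
for each index `i`, the vertex `v` of the `i`-th copy is joined by a new edge to the vertex `u` of
the `(i + 1)`-th copy. -/
def circularArrangement (H : Graph α β) (u v : α) (k : ℕ) :
    Graph (ZMod k × α) ((ZMod k × β) ⊕ ZMod k) where
  vertexSet := {p | p.2 ∈ V(H)}
  IsLink e x y := match e with
    | .inl (i, e) => x.1 = i ∧ y.1 = i ∧ H.IsLink e x.2 y.2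
    | .inr i => u ∈ V(H) ∧ v ∈ V(H) ∧ s(x, y) = s((i, v), (i + 1, u))
  isLink_symm e _ := by
    refine ⟨fun x y h => ?_⟩
    rcases e with ⟨i, e⟩ | i
    · exact ⟨h.2.1, h.1, h.2.2.symm⟩
    · exact ⟨h.1, h.2.1, Sym2.eq_swap.trans h.2.2⟩
  eq_or_eq_of_isLink_of_isLink e x y z w h h' := by
    rcases e with ⟨i, e⟩ | i
    · rcases h.2.2.left_eq_or_eq h'.2.2 with h2 | h2
      · exact Or.inl (Prod.ext (h.1.trans h'.1.symm) h2)
      · exact Or.inr (Prod.ext (h.1.trans h'.2.1.symm) h2)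
    · have h2 : s(x, y) = s(z, w) := h.2.2.trans h'.2.2.symm
      rw [Sym2.eq_iff] at h2
      tauto
  left_mem_of_isLink e x y h := by
    rcases e with ⟨i, e⟩ | i
    · exact h.2.2.left_mem
    · have h2 := h.2.2
      rw [Sym2.eq_iff] at h2
      rcases h2 with ⟨rfl, _⟩ | ⟨rfl, _⟩
      · exact h.2.1
      · exact h.1

/-- The multigraph with sparse6 code `:LiAGWAJ?XApEOsPcL?XAv`: 13 vertices, 23 edges, one pair of
parallel edges, and the two pendant vertices `2` and `12`. -/
def baseMultigraph : Graph (Fin 13) (Fin 23) :=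
  ofEnds ![s(0, 5), s(1, 6), s(1, 6), s(0, 7), s(2, 7), s(5, 7), s(0, 8), s(3, 8), s(4, 8),
    s(5, 8), s(1, 9), s(3, 9), s(4, 9), s(6, 9), s(1, 10), s(3, 10), s(4, 10), s(6, 10),
    s(0, 11), s(3, 11), s(4, 11), s(5, 11), s(7, 12)]

end Graph

/-! For the lower bound $\chi_c'(H)\ge 19/4$, write the conditions of a circular $r$-edge-colouring
as arc inequalities on the line graph. A closed walk of length $n$ that wraps $B$ times around the
circle forces $n\le rB$. Conversely, if every simple cycle satisfies $n\le\tfrac{14}{3}B$, a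
potential yields a circular $14/3$-colouring. No fraction with numerator at most $23$ lies strictly
between $14/3$ and $19/4$, so a colouring with $r<19/4$ gives one by residues modulo $14$
(`exists_fourteen_thirds_colouring`). An exhaustive search excludes this
(`noBaseColouring_eq_true`).

The upper bound is an explicit colouring modulo $19$ that leaves one colour free at both pendant
vertices; this colour serves every linking edge of $G_k$, while the lower bound passes to $G_k$ by
restriction to one copy.

For connectivity, vertex $7$ is the hub of each copy. It cuts off the rest of its copy, to which it
sends only two edges. Two edge-disjoint spanning trees in each copy and the cyclic order of the hubs
show that one deleted edge never disconnects $G_k$. The order $13k$ separates the isomorphism types.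
-/

/-! ### Potentials on a finite digraph without positive cycles -/

/-- The total weight of the walk whose successive vertices, from the last to the first, are the
entries of the list. -/
def walkWeight {ι : Type*} (w : ι → ι → ℤ) : List ι → ℤ
  | [] => 0
  | [_] => 0
  | x :: y :: l => w y x + walkWeight w (y :: l)

theorem walkWeight_append {ι : Type*} (w : ι → ι → ℤ) (l₁ : List ι) (y : ι) (l₂ : List ι) :
    walkWeight w (l₁ ++ y :: l₂) = walkWeight w (l₁ ++ [y]) + walkWeight w (y :: l₂) := by
  induction l₁ with
  | nil => simp [walkWeight]
  | cons a t ih =>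
    cases t with
    | nil => simp [walkWeight]
    | cons b t =>
      simp only [List.cons_append, walkWeight] at ih ⊢
      rw [ih, add_assoc]

/-- If no simple directed cycle has positive weight, there is a feasible potential. -/
theorem exists_potential {ι : Type*} [Finite ι] (R : ι → ι → Prop) (w : ι → ι → ℤ)
    (hcyc : ∀ (l : List ι) (x y : ι), l.Nodup → l.IsChain (fun a b => R b a) →
      l.head? = some x → l.getLast? = some y → R x y → walkWeight w l + w x y ≤ 0) :
    ∃ d : ι → ℤ, ∀ x y, R x y → d x + w x y ≤ d y := by
  classical
  have : Fintype ι := Fintype.ofFinite ι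
  -- The potential at `x` is the largest weight of a simple walk ending at `x`; there are finitely
  -- many such walks.
  let S : ι → Set (List ι) := fun x =>
    {l | l.Nodup ∧ l.IsChain (fun a b => R b a) ∧ l.head? = some x}
  have hfin : ∀ x, (S x).Finite := fun x =>
    (List.finite_length_le ι (Fintype.card ι)).subset fun l hl => hl.1.length_le_card
  have hne : ∀ x, (S x).Nonempty := fun x => ⟨[x], by simp [S]⟩
  choose L hL hmax using fun x => (S x).exists_max_image (walkWeight w) (hfin x) (hne x)
  refine ⟨fun x => walkWeight w (L x), fun x y hxy => ?_⟩
  obtain ⟨hnd, hch, hhd⟩ := hL x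
  -- If `y` lies on the optimal walk to `x`, cut the walk there: the part from `y` to `x` closes up
  -- with the arc to a simple cycle, and the rest competes for the potential of `y`. Otherwise the
  -- walk extends to `y`.
  by_cases hy : y ∈ L x
  · obtain ⟨l₁, l₂, hl⟩ := List.append_of_mem hy
    have hsplit : L x = (l₁ ++ [y]) ++ l₂ := by simp [hl]
    have h1 : walkWeight w (l₁ ++ [y]) + w x y ≤ 0 := by
      apply hcyc
      · rw [hsplit] at hnd; exact hnd.of_append_left
      · rw [hsplit] at hch; exact (List.isChain_append.1 hch).1
      · rw [← hhd, hsplit]; cases l₁ <;> simp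
      · simp
      · exact hxy
    have h2 : walkWeight w (y :: l₂) ≤ walkWeight w (L y) := by
      apply hmax
      refine ⟨?_, ?_, by simp⟩
      · rw [hl] at hnd; exact hnd.of_append_right
      · rw [hl] at hch; exact (List.isChain_append.1 hch).2.1
    have h3 := walkWeight_append w l₁ y l₂
    rw [← hl] at h3
    dsimp only
    linarith
  · obtain ⟨t, ht⟩ : ∃ t, L x = x :: t := by
      cases h : L x with
      | nil => simp [h] at hhd
      | cons a t => rw [h] at hhd; simp at hhd; exact ⟨t, by rw [hhd]⟩
    have h2 : walkWeight w (y :: L x) ≤ walkWeight w (L y) := by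
      apply hmax
      refine ⟨List.nodup_cons.2 ⟨hy, hnd⟩, ?_, by simp⟩
      rw [ht] at hch ⊢
      exact List.isChain_cons_cons.2 ⟨hxy, hch⟩
    rw [ht] at h2
    simp only [walkWeight] at h2
    dsimp only
    rw [ht]
    linarith

/-- A circular `r`-colouring of a graph with at most `23` vertices and `r < 19 / 4` can be replaced
by a circular `14 / 3`-colouring, here given by integers modulo `14` in units of `1 / 3`. -/
theorem exists_fourteen_thirds_colouring {ι : Type*} [Fintype ι] (hcard : Fintype.card ι ≤ 23)
    (adj : ι → ι → Prop) {r : ℝ} (hr : r < 19 / 4) (c : ι → ℝ)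
    (hc : ∀ x y, adj x y → 1 ≤ |c x - c y| ∧ |c x - c y| ≤ r - 1) :
    ∃ d : ι → ℤ, ∀ x y, adj x y →
      (3 ≤ d x - d y ∧ d x - d y ≤ 11) ∨ (3 ≤ d y - d x ∧ d y - d x ≤ 11) := by
  classical
  -- `b x y = 1` records that moving up from the colour of `x` to that of `y` wraps past `r`.
  let b : ι → ι → ℤ := fun x y => if c x < c y then 0 else 1
  let R : ι → ι → Prop := fun x y => adj x y ∨ adj y x
  have harc : ∀ x y, R x y → c x + 1 - r * b x y ≤ c y := by
    intro x y h
    have h' : 1 ≤ |c x - c y| ∧ |c x - c y| ≤ r - 1 := by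
      rcases h with h | h
      · exact hc x y h
      · rw [abs_sub_comm]; exact hc y x h
    by_cases hxy : c x < c y
    · rw [abs_of_neg (by linarith)] at h'
      simp only [b, hxy, if_true]
      push_cast
      linarith
    · rw [abs_of_nonneg (by linarith)] at h'
      simp only [b, hxy, if_false]
      push_cast
      linarith
  -- Telescoping: one wrap count `B` governs both the integer weight and the real inequality.
  have hwalk : ∀ (l : List ι) (x y : ι), l.IsChain (fun a b => R b a) →
      l.head? = some x → l.getLast? = some y → ∃ B : ℤ,
      walkWeight (fun x y => 3 - 14 * b x y) l = 3 * ((l.length : ℤ) - 1) - 14 * B ∧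
      c y + ((l.length : ℤ) - 1 : ℤ) - r * B ≤ c x := by
    intro l
    induction l with
    | nil => simp
    | cons a t ih =>
      cases t with
      | nil =>
        intro x y _ hx hy
        simp at hx hy
        subst hx hy
        exact ⟨0, by simp [walkWeight], by simp⟩
      | cons a' t =>
        intro x y hch hx hy
        rw [List.isChain_cons_cons] at hch
        simp only [List.head?_cons, Option.some.injEq] at hx
        subst hx
        obtain ⟨B, h1, h2⟩ := ih a' y hch.2 (by simp) (by simpa using hy)
        refine ⟨B + b a' a, ?_, ?_⟩
        · simp only [walkWeight, h1, List.length_cons]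
          push_cast
          ring
        · have h3 := harc _ _ hch.1
          simp only [List.length_cons] at h2 ⊢
          push_cast at h2 ⊢
          linarith
  obtain ⟨d, hd⟩ := exists_potential R (fun x y => 3 - 14 * b x y) (by
    intro l x y hnd hch hx hy hxy
    obtain ⟨B, h1, h2⟩ := hwalk l x y hch hx hy
    have h3 := harc x y hxy
    have hlen : (l.length : ℤ) ≤ 23 := by exact_mod_cast hnd.length_le_card.trans hcard
    have hpos : 1 ≤ (l.length : ℤ) := by
      cases l with
      | nil => simp at hx
      | cons a t => simp
    -- The closing arc makes the colours cancel.
    have h4 : (l.length : ℝ) ≤ r * ((B + b x y : ℤ) : ℝ) := by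
      push_cast at h2 ⊢
      linarith
    have hpos' : (1 : ℝ) ≤ l.length := by exact_mod_cast hpos
    have hadj : 1 ≤ r - 1 := by
      rcases hxy with h | h
      · exact (hc x y h).1.trans (hc x y h).2
      · exact (hc y x h).1.trans (hc y x h).2
    have h5 : (0 : ℝ) < ((B + b x y : ℤ) : ℝ) := by
      by_contra hneg
      push Not at hneg
      nlinarith
    have h6 : 4 * (l.length : ℝ) < 19 * ((B + b x y : ℤ) : ℝ) := by nlinarith
    have h7 : 4 * (l.length : ℤ) < 19 * (B + b x y) := by exact_mod_cast h6
    -- Since $3\cdot19-4\cdot14=1$, a fraction strictly between $14/3$ and $19/4$ has numerator at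
    -- least $14+19=33>23$.
    rw [h1]
    lia)
  refine ⟨d, fun x y hxy => ?_⟩
  have h1 := hd x y (Or.inl hxy)
  have h2 := hd y x (Or.inr hxy)
  have h3 := (hc x y hxy).1
  rcases lt_trichotomy (c x) (c y) with h | h | h
  · simp only [b, h, h.not_gt, if_true, if_false] at h1 h2
    lia
  · rw [h, sub_self, abs_zero] at h3
    linarith
  · simp only [b, h, h.not_gt, if_true, if_false] at h1 h2
    lia

/-! ### The base multigraph has no circular `14 / 3`-edge-colouring -/

/-- The set, as a bit mask, of the residues modulo `14` at circular distance at least `3` from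
`c`. -/
def farMask (c : ℕ) : ℕ :=
  -- `4088` has exactly the bits 3 to 11, the residues far from 0; it is rotated by `c` within the
  -- 14 bits of `16383`.
  Nat.land (Nat.lor (Nat.shiftLeft 4088 c) (Nat.shiftRight 4088 (14 - c))) 16383

/-- Two residues modulo `14` are at circular distance at least `3`. -/
def Far (a b : ℕ) : Prop :=
  (3 + a ≤ b ∧ b ≤ a + 11) ∨ (3 + b ≤ a ∧ a ≤ b + 11)

instance (a b : ℕ) : Decidable (Far a b) := by unfold Far; infer_instance

/-- Only this direction is needed: the search must not miss an admissible colour. -/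
theorem testBit_farMask {a b : ℕ} (ha : a < 14) (hb : b < 14) (h : Far a b) :
    (farMask a).testBit b = true := by
  revert h
  revert hb
  revert b
  revert ha
  revert a
  decide

/-- `f` holds at all elements below `14` of the set with bit mask `m`. -/
def allBits (m : ℕ) (f : ℕ → Bool) : Bool :=
  [0, 1, 2, 3, 4, 5, 6, 7, 8, 9, 10, 11, 12, 13].all fun c =>
    !(Nat.beq (Nat.land 1 (Nat.shiftRight m c)) 1) || f c

theorem allBits_spec {m : ℕ} {f : ℕ → Bool} (h : allBits m f = true) {c : ℕ} (hc : c < 14)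
    (hm : m.testBit c = true) : f c = true := by
  have hmem : c ∈ [0, 1, 2, 3, 4, 5, 6, 7, 8, 9, 10, 11, 12, 13] := by
    simp only [List.mem_cons, List.not_mem_nil]
    lia
  have h1 := List.all_eq_true.1 h c hmem
  have h2 : Nat.beq (Nat.land 1 (Nat.shiftRight m c)) 1 = true := by
    rw [Nat.beq_eq]
    have h3 : (1 &&& (m >>> c)) ≠ 0 := by
      simpa [Nat.testBit] using hm
    have h4 : 1 &&& (m >>> c) < 2 := Nat.lt_of_le_of_lt Nat.and_le_left (by norm_num)
    change 1 &&& (m >>> c) = 1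
    lia
  rw [h2] at h1
  simpa only [Bool.not_true, Bool.false_or] using h1

/-- No colouring of the gadget on `{1, 6, 9, 10}` has the given colours on the edges that leave
`9` (`p`, `q`) and `10` (`r`, `s`). -/
def noDoubleGadget (p q r s : ℕ) : Bool :=
  allBits (Nat.land (farMask p) (farMask q)) fun x =>
  allBits (Nat.land (Nat.land (farMask p) (farMask q)) (farMask x)) fun y =>
  allBits (Nat.land (Nat.land (farMask r) (farMask s)) (farMask x)) fun z =>
  allBits (Nat.land (Nat.land (Nat.land (farMask r) (farMask s)) (farMask y)) (farMask z)) fun w =>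
  allBits (Nat.land (Nat.land (farMask x) (farMask y)) (Nat.land (farMask z) (farMask w))) fun a =>
  -- An empty mask means that no colour is left for the second of the parallel edges, which meets
  -- all of the other five.
  Nat.beq (Nat.land (Nat.land (Nat.land (farMask x) (farMask y))
    (Nat.land (farMask z) (farMask w))) (farMask a)) 0

/-- No colouring of the gadget on `{0, 5, 7, 8, 11}` has the given colours on the edges that leave
`8` (`p`, `q`) and `11` (`r`, `s`). -/
def noTriangleGadget (p q r s : ℕ) : Bool :=
  allBits (Nat.land (farMask p) (farMask q)) fun x =>
  allBits (Nat.land (Nat.land (farMask p) (farMask q)) (farMask x)) fun y =>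
  allBits (Nat.land (Nat.land (farMask r) (farMask s)) (farMask x)) fun z =>
  allBits (Nat.land (Nat.land (Nat.land (farMask r) (farMask s)) (farMask y)) (farMask z)) fun w =>
  allBits (Nat.land (Nat.land (farMask x) (farMask y)) (Nat.land (farMask z) (farMask w))) fun e =>
  allBits (Nat.land (Nat.land (farMask e) (farMask x)) (farMask z)) fun a =>
  Nat.beq (Nat.land (Nat.land (Nat.land (farMask e) (farMask y)) (farMask w)) (farMask a)) 0

/-- The exhaustive search over the colours of the eight edges at `3` and `4`, the first of which
has colour `0`. -/
def noBaseColouring : Bool :=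
  allBits (farMask 0) fun q =>
  allBits (farMask 0) fun r =>
  allBits (Nat.land (farMask q) (farMask r)) fun s =>
  -- The two gadgets interact only through the edges at 3 and 4, so the second is examined only when
  -- the first can be coloured.
  noDoubleGadget 0 q r s ||
  allBits (Nat.land (farMask 0) (farMask r)) fun p' =>
  allBits (Nat.land (Nat.land (farMask 0) (farMask r)) (farMask p')) fun r' =>
  allBits (Nat.land (Nat.land (farMask q) (farMask s)) (farMask p')) fun q' =>
  allBits (Nat.land (Nat.land (Nat.land (farMask q) (farMask s)) (farMask r')) (farMask q')) fun s' =>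
  noTriangleGadget p' q' r' s'

-- The two pendant edges take no part in the search: the obstruction already lies in the multigraph
-- without 2 and 12.
set_option maxRecDepth 100000 in
theorem noBaseColouring_eq_true : noBaseColouring = true := by
  decide +kernel

namespace Graph

variable {α β : Type*}

theorem inc_ofEnds {ends : β → Sym2 α} {e : β} {x : α} :
    (ofEnds ends).Inc e x ↔ x ∈ ends e := by
  simp only [Graph.Inc, ofEnds, Sym2.mem_iff_exists]

theorem isLoopAt_ofEnds {ends : β → Sym2 α} {e : β} {x : α} :
    (ofEnds ends).IsLoopAt e x ↔ ends e = s(x, x) := Iff.rfl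

/-- The list of ends of the edges of `baseMultigraph`. -/
def baseEnds : Fin 23 → Sym2 (Fin 13) :=
  ![s(0, 5), s(1, 6), s(1, 6), s(0, 7), s(2, 7), s(5, 7), s(0, 8), s(3, 8), s(4, 8),
    s(5, 8), s(1, 9), s(3, 9), s(4, 9), s(6, 9), s(1, 10), s(3, 10), s(4, 10), s(6, 10),
    s(0, 11), s(3, 11), s(4, 11), s(5, 11), s(7, 12)]

theorem baseMultigraph_eq : baseMultigraph = ofEnds baseEnds := rfl

theorem testBit_land (a b c : ℕ) : (Nat.land a b).testBit c = (a.testBit c && b.testBit c) :=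
  Nat.testBit_and a b c

theorem no_beq_zero {m c : ℕ} (hm : m.testBit c = true) : Nat.beq m 0 ≠ true := by
  intro h
  rw [Nat.beq_eq] at h
  simp [h] at hm

/-- The edges of `baseMultigraph` have no assignment of residues modulo `14` in which adjacent
edges are at circular distance at least `3`. -/
theorem not_exists_residue_colouring (d : Fin 23 → ℕ) (hd : ∀ e, d e < 14) (h0 : d 11 = 0)
    (h : ∀ e f, e ≠ f → (∃ x, x ∈ baseEnds e ∧ x ∈ baseEnds f) → Far (d e) (d f)) : False := by
  have T : ∀ e f, e ≠ f → (∃ x, x ∈ baseEnds e ∧ x ∈ baseEnds f) →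
      (farMask (d e)).testBit (d f) = true := fun e f h1 h2 =>
    testBit_farMask (hd e) (hd f) (h e f h1 h2)
  have Z : ∀ f, 11 ≠ f → (∃ x, x ∈ baseEnds 11 ∧ x ∈ baseEnds f) →
      (farMask 0).testBit (d f) = true := fun f h1 h2 => by
    rw [← h0]; exact T 11 f h1 h2
  have key := noBaseColouring_eq_true
  unfold noBaseColouring at key
  -- `q`, `r`, `s` are the colours of edges 12, 15, 16; later `p'`, `r'`, `q'`, `s'` are those of 7,
  -- 19, 8, 20.
  have k1 := allBits_spec key (hd 12) (Z 12 (by decide) (by decide))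
  have k2 := allBits_spec k1 (hd 15) (Z 15 (by decide) (by decide))
  have k3 := allBits_spec k2 (hd 16) (by
    simp only [testBit_land, T 12 16 (by decide) (by decide), T 15 16 (by decide) (by decide),
      Bool.and_self])
  rcases Bool.or_eq_true_iff.1 k3 with k | k
  · unfold noDoubleGadget at k
    have l1 := allBits_spec k (hd 10) (by
      simp only [testBit_land, Z 10 (by decide) (by decide), T 12 10 (by decide) (by decide),
        Bool.and_self])
    have l2 := allBits_spec l1 (hd 13) (by
      simp only [testBit_land, Z 13 (by decide) (by decide), T 12 13 (by decide) (by decide),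
        T 10 13 (by decide) (by decide), Bool.and_self])
    have l3 := allBits_spec l2 (hd 14) (by
      simp only [testBit_land, T 15 14 (by decide) (by decide), T 16 14 (by decide) (by decide),
        T 10 14 (by decide) (by decide), Bool.and_self])
    have l4 := allBits_spec l3 (hd 17) (by
      simp only [testBit_land, T 15 17 (by decide) (by decide), T 16 17 (by decide) (by decide),
        T 13 17 (by decide) (by decide), T 14 17 (by decide) (by decide), Bool.and_self])
    have l5 := allBits_spec l4 (hd 1) (by
      simp only [testBit_land, T 10 1 (by decide) (by decide), T 13 1 (by decide) (by decide),
        T 14 1 (by decide) (by decide), T 17 1 (by decide) (by decide), Bool.and_self])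
    refine no_beq_zero (c := d 2) ?_ l5
    simp only [testBit_land, T 10 2 (by decide) (by decide), T 13 2 (by decide) (by decide),
      T 14 2 (by decide) (by decide), T 17 2 (by decide) (by decide),
      T 1 2 (by decide) (by decide), Bool.and_self]
  · have k4 := allBits_spec k (hd 7) (by
      simp only [testBit_land, Z 7 (by decide) (by decide), T 15 7 (by decide) (by decide),
        Bool.and_self])
    have k5 := allBits_spec k4 (hd 19) (by
      simp only [testBit_land, Z 19 (by decide) (by decide), T 15 19 (by decide) (by decide),
        T 7 19 (by decide) (by decide), Bool.and_self])
    have k6 := allBits_spec k5 (hd 8) (by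
      simp only [testBit_land, T 12 8 (by decide) (by decide), T 16 8 (by decide) (by decide),
        T 7 8 (by decide) (by decide), Bool.and_self])
    have k7 := allBits_spec k6 (hd 20) (by
      simp only [testBit_land, T 12 20 (by decide) (by decide), T 16 20 (by decide) (by decide),
        T 19 20 (by decide) (by decide), T 8 20 (by decide) (by decide), Bool.and_self])
    unfold noTriangleGadget at k7
    have l1 := allBits_spec k7 (hd 6) (by
      simp only [testBit_land, T 7 6 (by decide) (by decide), T 8 6 (by decide) (by decide),
        Bool.and_self])
    have l2 := allBits_spec l1 (hd 9) (by
      simp only [testBit_land, T 7 9 (by decide) (by decide), T 8 9 (by decide) (by decide),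
        T 6 9 (by decide) (by decide), Bool.and_self])
    have l3 := allBits_spec l2 (hd 18) (by
      simp only [testBit_land, T 19 18 (by decide) (by decide), T 20 18 (by decide) (by decide),
        T 6 18 (by decide) (by decide), Bool.and_self])
    have l4 := allBits_spec l3 (hd 21) (by
      simp only [testBit_land, T 19 21 (by decide) (by decide), T 20 21 (by decide) (by decide),
        T 9 21 (by decide) (by decide), T 18 21 (by decide) (by decide), Bool.and_self])
    have l5 := allBits_spec l4 (hd 0) (by
      simp only [testBit_land, T 6 0 (by decide) (by decide), T 9 0 (by decide) (by decide),
        T 18 0 (by decide) (by decide), T 21 0 (by decide) (by decide), Bool.and_self])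
    have l6 := allBits_spec l5 (hd 3) (by
      simp only [testBit_land, T 0 3 (by decide) (by decide), T 6 3 (by decide) (by decide),
        T 18 3 (by decide) (by decide), Bool.and_self])
    refine no_beq_zero (c := d 5) ?_ l6
    simp only [testBit_land, T 0 5 (by decide) (by decide), T 9 5 (by decide) (by decide),
      T 21 5 (by decide) (by decide), T 3 5 (by decide) (by decide), Bool.and_self]

theorem le_of_isCircularEdgeColouring_baseMultigraph {r : ℝ} {c : Fin 23 → ℝ}
    (hc : baseMultigraph.IsCircularEdgeColouring r c) : 19 / 4 ≤ r := by
  by_contra! hr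
  obtain ⟨d, hd⟩ := exists_fourteen_thirds_colouring (by simp)
    (fun e f => e ≠ f ∧ ∃ x, x ∈ baseEnds e ∧ x ∈ baseEnds f) hr c
    (fun e f ⟨hef, x, hx, hy⟩ => hc.2.2 e f x hef (inc_ofEnds.2 hx) (inc_ofEnds.2 hy))
  -- Rotating the circle preserves circular distances and gives edge 11 the colour 0.
  refine not_exists_residue_colouring (fun e => ((d e - d 11) % 14).toNat) (fun e => by lia)
    (by simp) fun e f hef hx => ?_
  have := hd e f ⟨hef, hx⟩
  unfold Far
  lia

/-! ### Incidences in a circular arrangement -/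

theorem baseMultigraph_inc {e : Fin 23} {x : Fin 13} :
    baseMultigraph.Inc e x ↔ x ∈ baseEnds e := inc_ofEnds

theorem baseMultigraph_not_isLoopAt (e : Fin 23) (x : Fin 13) :
    ¬ baseMultigraph.IsLoopAt e x := by
  rw [baseMultigraph_eq, isLoopAt_ofEnds]
  revert e x
  decide

section circularArrangement

variable {H : Graph α β} {u v : α} {k : ℕ}

theorem circularArrangement_inc_inl {i : ZMod k} {e : β} {p : ZMod k × α} :
    (H.circularArrangement u v k).Inc (.inl (i, e)) p ↔ p.1 = i ∧ H.Inc e p.2 := by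
  constructor
  · rintro ⟨q, h1, -, h2⟩
    exact ⟨h1, q.2, h2⟩
  · rintro ⟨h1, y, h2⟩
    exact ⟨(i, y), h1, rfl, h2⟩

theorem eq_or_eq_of_circularArrangement_inc_inr {i : ZMod k} {p : ZMod k × α}
    (h : (H.circularArrangement u v k).Inc (.inr i) p) : p = (i, v) ∨ p = (i + 1, u) := by
  obtain ⟨q, -, -, h⟩ := h
  rw [Sym2.eq_iff] at h
  tauto

theorem circularArrangement_not_isLoopAt (huv : u ≠ v) (hH : ∀ e x, ¬ H.IsLoopAt e x)
    (e : (ZMod k × β) ⊕ ZMod k) (p : ZMod k × α) :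
    ¬ (H.circularArrangement u v k).IsLoopAt e p := by
  rcases e with ⟨i, e⟩ | i
  · exact fun h => hH e p.2 h.2.2
  · rintro ⟨-, -, h⟩
    rw [Sym2.eq_iff] at h
    rcases h with ⟨h1, h2⟩ | ⟨h1, h2⟩
    · exact huv (congrArg Prod.snd (h2.symm.trans h1))
    · exact huv (congrArg Prod.snd (h1.symm.trans h2))

/-- A circular edge-colouring of a circular arrangement restricts to each copy. -/
theorem IsCircularEdgeColouring.of_circularArrangement {r : ℝ}
    {c : (ZMod k × β) ⊕ ZMod k → ℝ}
    (hc : (H.circularArrangement u v k).IsCircularEdgeColouring r c) (i : ZMod k) :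
    H.IsCircularEdgeColouring r fun e => c (.inl (i, e)) := by
  refine ⟨fun e he => ?_, fun e x h => ?_, fun e f x hef he hf => ?_⟩
  · obtain ⟨x, y, h⟩ := H.exists_isLink_of_mem_edgeSet he
    refine hc.1 _ (IsLink.edge_mem (x := (i, x)) (y := (i, y)) ?_)
    exact ⟨rfl, rfl, h⟩
  · exact hc.2.1 (.inl (i, e)) (i, x) ⟨rfl, rfl, h⟩
  · refine hc.2.2 _ _ (i, x) ?_ (circularArrangement_inc_inl.2 ⟨rfl, he⟩)
      (circularArrangement_inc_inl.2 ⟨rfl, hf⟩)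
    simpa using hef

end circularArrangement

/-! ### Circular `19 / 4`-edge-colourings -/

/-- Two residues modulo `19` are at circular distance at least `4`. -/
def FarNineteen (a b : ℤ) : Prop :=
  (4 ≤ a - b ∧ a - b ≤ 15) ∨ (4 ≤ b - a ∧ b - a ≤ 15)

instance (a b : ℤ) : Decidable (FarNineteen a b) := by unfold FarNineteen; infer_instance

theorem FarNineteen.symm {a b : ℤ} (h : FarNineteen a b) : FarNineteen b a := Or.symm h

/-- A colouring by residues modulo `19` gives a circular `19 / 4`-edge-colouring. -/
theorem isCircularEdgeColouring_of_farNineteen {G : Graph α β} (d : β → ℤ)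
    (hd : ∀ e, 0 ≤ d e ∧ d e < 19) (hloop : ∀ e x, ¬ G.IsLoopAt e x)
    (h : ∀ e f x, e ≠ f → G.Inc e x → G.Inc f x → FarNineteen (d e) (d f)) :
    G.IsCircularEdgeColouring (19 / 4) fun e => (d e : ℝ) / 4 := by
  refine ⟨fun e _ => ?_, hloop, fun e f x hef he hf => ?_⟩
  · have h1 : (0 : ℝ) ≤ d e := by exact_mod_cast (hd e).1
    have h2 : (d e : ℝ) < 19 := by exact_mod_cast (hd e).2
    constructor <;> linarith
  · rcases h e f x hef he hf with ⟨h1, h2⟩ | ⟨h1, h2⟩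
    · have h1 : (4 : ℝ) ≤ d e - d f := by exact_mod_cast h1
      have h2 : (d e : ℝ) - d f ≤ 15 := by exact_mod_cast h2
      rw [abs_of_nonneg (by linarith)]
      constructor <;> linarith
    · have h1 : (4 : ℝ) ≤ d f - d e := by exact_mod_cast h1
      have h2 : (d f : ℝ) - d e ≤ 15 := by exact_mod_cast h2
      rw [abs_of_nonpos (by linarith)]
      constructor <;> linarith

/-- A colouring of the edges of `baseMultigraph` by residues modulo `19`. -/
def baseColour : Fin 23 → ℤ :=
  ![14, 0, 9, 18, 3, 10, 3, 12, 7, 18, 4, 8, 17, 13, 15, 1, 11, 5, 10, 16, 2, 6, 14]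

theorem baseColour_bounds : ∀ e, 0 ≤ baseColour e ∧ baseColour e < 19 := by
  decide

theorem farNineteen_baseColour : ∀ e f x, e ≠ f → x ∈ baseEnds e → x ∈ baseEnds f →
    FarNineteen (baseColour e) (baseColour f) := by
  decide +kernel

theorem baseMultigraph_hasCircularChromaticIndex :
    baseMultigraph.HasCircularChromaticIndex (19 / 4) := by
  refine ⟨⟨_, isCircularEdgeColouring_of_farNineteen baseColour baseColour_bounds
    baseMultigraph_not_isLoopAt fun e f x hef he hf => ?_⟩, ?_⟩
  · exact farNineteen_baseColour e f x hef (baseMultigraph_inc.1 he) (baseMultigraph_inc.1 hf)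
  · rintro r ⟨c, hc⟩
    exact le_of_isCircularEdgeColouring_baseMultigraph hc

/-- The pendant edges have colours 3 and 14, each at circular distance exactly 4 from 18. -/
theorem farNineteen_baseColour_link : ∀ e, 12 ∈ baseEnds e ∨ 2 ∈ baseEnds e →
    FarNineteen (baseColour e) 18 := by
  decide +kernel

/-- Every copy is coloured alike. Linking edges are pairwise disjoint, so all can receive 18. -/
theorem circularArrangement_hasCircularChromaticIndex (k : ℕ) :
    (baseMultigraph.circularArrangement 2 12 k).HasCircularChromaticIndex (19 / 4) := by
  have hlink : ∀ (i j : ZMod k) (e : Fin 23) (p : ZMod k × Fin 13),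
      (baseMultigraph.circularArrangement 2 12 k).Inc (.inl (i, e)) p →
      (baseMultigraph.circularArrangement 2 12 k).Inc (.inr j) p →
      FarNineteen (baseColour e) 18 := by
    intro i j e p h1 h2
    have h3 := baseMultigraph_inc.1 (circularArrangement_inc_inl.1 h1).2
    apply farNineteen_baseColour_link
    rcases eq_or_eq_of_circularArrangement_inc_inr h2 with rfl | rfl
    · exact Or.inl h3
    · exact Or.inr h3
  refine ⟨⟨_, isCircularEdgeColouring_of_farNineteen
    (Sum.elim (fun e => baseColour e.2) fun _ => 18) ?_
    (circularArrangement_not_isLoopAt (by decide) baseMultigraph_not_isLoopAt) ?_⟩, ?_⟩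
  · rintro (e | i)
    · exact baseColour_bounds e.2
    · simp
  · rintro (⟨i, e⟩ | i) (⟨j, f⟩ | j) p hef he hf
    · rw [circularArrangement_inc_inl] at he hf
      obtain rfl : i = j := he.1.symm.trans hf.1
      exact farNineteen_baseColour e f p.2 (by rintro rfl; exact hef rfl)
        (baseMultigraph_inc.1 he.2) (baseMultigraph_inc.1 hf.2)
    · exact hlink i j e p he hf
    · exact (hlink j i f p hf he).symm
    · exfalso
      apply hef
      rcases eq_or_eq_of_circularArrangement_inc_inr he with rfl | rfl <;>
        rcases eq_or_eq_of_circularArrangement_inc_inr hf with h | h <;>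
        simp_all
  · rintro r ⟨c, hc⟩
    exact le_of_isCircularEdgeColouring_baseMultigraph (hc.of_circularArrangement 0)

/-! ### Degrees -/

theorem degree_eq_encard_inc {G : Graph α β} (hG : ∀ e x, ¬ G.IsLoopAt e x) (x : α) :
    G.degree x = {e | G.Inc e x}.encard := by
  simp [degree, isNonloopAt_iff_inc_not_isLoopAt, hG]

theorem baseMultigraph_degree (x : Fin 13) :
    baseMultigraph.degree x = (Finset.univ.filter fun e => x ∈ baseEnds e).card := by
  rw [degree_eq_encard_inc baseMultigraph_not_isLoopAt, ← Set.encard_coe_eq_coe_finsetCard]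
  congr 1
  ext e
  simp [baseMultigraph_inc]

theorem baseMultigraph_degree_eq_one_iff (x : Fin 13) :
    baseMultigraph.degree x = 1 ↔ x = 2 ∨ x = 12 := by
  rw [baseMultigraph_degree, Nat.cast_eq_one]
  revert x
  decide

theorem circularArrangement_degree {k : ℕ} (p : ZMod k × Fin 13) :
    (baseMultigraph.circularArrangement 2 12 k).degree p = baseMultigraph.degree p.2 +
      {i | (baseMultigraph.circularArrangement 2 12 k).Inc (.inr i) p}.encard := by
  rw [degree_eq_encard_inc (circularArrangement_not_isLoopAt (by decide)
    baseMultigraph_not_isLoopAt), degree_eq_encard_inc baseMultigraph_not_isLoopAt]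
  have h1 : Function.Injective fun e : Fin 23 =>
      (Sum.inl (p.1, e) : (ZMod k × Fin 23) ⊕ ZMod k) := fun e f h => by simpa using h
  have h2 : Function.Injective fun i : ZMod k =>
      (Sum.inr i : (ZMod k × Fin 23) ⊕ ZMod k) := Sum.inr_injective
  rw [← h1.encard_image, ← h2.encard_image, ← Set.encard_union_eq]
  · congr 1
    ext (⟨i, e⟩ | i)
    · simp [circularArrangement_inc_inl, and_comm]
    · simp
  · rw [Set.disjoint_left]
    rintro _ ⟨e, -, rfl⟩ ⟨i, -, h⟩
    simp at h

theorem circularArrangement_maxDegree (k : ℕ) :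
    (baseMultigraph.circularArrangement 2 12 k).maxDegree = 4 := by
  refine le_antisymm (iSup₂_le fun p _ => ?_) ?_
  · rw [circularArrangement_degree]
    have hdeg : ∀ x, baseMultigraph.degree x ≤ 4 := fun x => by
      rw [baseMultigraph_degree]
      norm_cast
      revert x
      decide
    by_cases h : p.2 = 2 ∨ p.2 = 12
    · have h1 : {i | (baseMultigraph.circularArrangement 2 12 k).Inc (.inr i) p} ⊆
          {p.1, p.1 - 1} := by
        intro i hi
        rcases eq_or_eq_of_circularArrangement_inc_inr hi with rfl | rfl <;> simp
      calc _ ≤ (1 : ℕ∞) + 2 := add_le_add ((baseMultigraph_degree_eq_one_iff _).2 h).le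
            ((Set.encard_le_encard h1).trans ((Set.encard_insert_le _ _).trans
              (by rw [Set.encard_singleton, one_add_one_eq_two])))
        _ ≤ 4 := by norm_num
    · have h1 : {i | (baseMultigraph.circularArrangement 2 12 k).Inc (.inr i) p} = ∅ := by
        rw [Set.eq_empty_iff_forall_notMem]
        intro i hi
        rcases eq_or_eq_of_circularArrangement_inc_inr hi with rfl | rfl <;> simp at h
      rw [h1, Set.encard_empty, add_zero]
      exact hdeg _
  · refine le_trans ?_ (le_iSup₂ (0, 0) (Set.mem_univ _))
    rw [circularArrangement_degree, baseMultigraph_degree]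
    exact le_add_right (by norm_cast)

/-! ### Connectivity -/

/-- A set of vertices that is closed under adjacency contains everything reachable from it. -/
theorem not_connected_of_closed {G : Graph α β} (S : α → Prop)
    (hS : ∀ e x y, G.IsLink e x y → S x → S y) {x y : α} (hx : x ∈ V(G)) (hy : y ∈ V(G))
    (hxS : S x) (hyS : ¬ S y) : ¬ G.Connected := by
  intro h
  have : ∀ z, Relation.ReflTransGen G.Adj x z → S z := fun z hz => by
    induction hz with
    | refl => exact hxS
    | tail _ h ih => obtain ⟨e, he⟩ := h; exact hS e _ _ he ih
  exact hyS (this y (h.2 x hx y hy))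

theorem reflTransGen_adj_symm {G : Graph α β} {x y : α} (h : Relation.ReflTransGen G.Adj x y) :
    Relation.ReflTransGen G.Adj y x := by
  induction h with
  | refl => exact Relation.ReflTransGen.refl
  | tail _ h ih => exact Relation.ReflTransGen.head h.symm ih

/-- The edges to the parent in two edge-disjoint spanning trees, with root `7`, of
`baseMultigraph` without `2` and `12`. -/
def treeEdge : Bool → Fin 13 → Fin 23
  | true => ![0, 1, 0, 15, 20, 5, 17, 0, 6, 10, 16, 21, 0]
  | false => ![3, 2, 0, 19, 8, 9, 13, 0, 7, 11, 14, 18, 0]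

/-- The parents in the two spanning trees. -/
def treeParent : Bool → Fin 13 → Fin 13
  | true => ![5, 6, 0, 10, 11, 7, 10, 0, 0, 1, 4, 5, 0]
  | false => ![7, 6, 0, 11, 8, 8, 9, 0, 3, 3, 1, 0, 0]

/-- The depths in the two spanning trees. -/
def treeDepth : Bool → Fin 13 → ℕ
  | true => ![2, 6, 0, 5, 3, 1, 5, 0, 3, 7, 4, 2, 0]
  | false => ![1, 6, 0, 3, 5, 5, 5, 0, 4, 4, 7, 2, 0]

/-- The table entries at 2, 7 and 12 are fillers. The strict decrease of depth drives the induction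
in `reach_of_tree`. -/
theorem tree_spec : ∀ t v, v ≠ 2 → v ≠ 12 → v ≠ 7 →
    baseEnds (treeEdge t v) = s(v, treeParent t v) ∧ treeParent t v ≠ 2 ∧
      treeParent t v ≠ 12 ∧ treeDepth t (treeParent t v) < treeDepth t v := by
  decide

theorem treeEdge_disjoint : ∀ v w, v ≠ 2 → v ≠ 12 → v ≠ 7 → w ≠ 2 → w ≠ 12 → w ≠ 7 →
    treeEdge true v ≠ treeEdge false w := by
  decide

/-! ### Connectedness after the deletion of at most one edge -/

section deleteEdges

variable {k : ℕ} {F : Set ((ZMod k × Fin 23) ⊕ ZMod k)}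

/-- Reachability in the circular arrangement after the deletion of the edges in `F`. -/
def Reach (F : Set ((ZMod k × Fin 23) ⊕ ZMod k)) (p q : ZMod k × Fin 13) : Prop :=
  Relation.ReflTransGen ((baseMultigraph.circularArrangement 2 12 k).deleteEdges F).Adj p q

theorem Reach.symm {p q : ZMod k × Fin 13} (h : Reach F p q) : Reach F q p :=
  reflTransGen_adj_symm h

theorem Reach.trans {p q s : ZMod k × Fin 13} (h : Reach F p q) (h' : Reach F q s) :
    Reach F p s :=
  Relation.ReflTransGen.trans h h'

theorem reach_of_edge {i : ZMod k} {e : Fin 23} {x y : Fin 13} (h : baseEnds e = s(x, y))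
    (he : Sum.inl (i, e) ∉ F) : Reach F (i, x) (i, y) :=
  Relation.ReflTransGen.single ⟨.inl (i, e), ⟨rfl, rfl, h⟩, he⟩

theorem reach_of_link {i : ZMod k} (he : Sum.inr i ∉ F) : Reach F (i, 12) (i + 1, 2) :=
  Relation.ReflTransGen.single ⟨.inr i, ⟨Set.mem_univ _, Set.mem_univ _, rfl⟩, he⟩

theorem reach_of_tree (i : ZMod k) (t : Bool)
    (h : ∀ v, v ≠ 2 → v ≠ 12 → v ≠ 7 → Sum.inl (i, treeEdge t v) ∉ F) (v : Fin 13)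
    (h2 : v ≠ 2) (h12 : v ≠ 12) : Reach F (i, v) (i, 7) := by
  induction hn : treeDepth t v using Nat.strong_induction_on generalizing v with
  | _ n ih =>
    by_cases h7 : v = 7
    · rw [h7]; exact Relation.ReflTransGen.refl
    · obtain ⟨h3, h4, h5, h6⟩ := tree_spec t v h2 h12 h7
      exact (reach_of_edge h3 (h v h2 h12 h7)).trans (ih _ (hn ▸ h6) _ h4 h5 rfl)

/-- The deleted edge lies in at most one of the two trees, so the other still leads to the hub. -/
theorem reach_hub_of_ne (hF : F.Subsingleton) (i : ZMod k) (v : Fin 13)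
    (h2 : v ≠ 2) (h12 : v ≠ 12) : Reach F (i, v) (i, 7) := by
  by_cases h : ∃ w, w ≠ 2 ∧ w ≠ 12 ∧ w ≠ 7 ∧ Sum.inl (i, treeEdge true w) ∈ F
  · obtain ⟨w, hw2, hw12, hw7, hw⟩ := h
    refine reach_of_tree i false (fun v hv2 hv12 hv7 hv => ?_) v h2 h12
    have := hF hw hv
    simp only [Sum.inl.injEq, Prod.mk.injEq, true_and] at this
    exact treeEdge_disjoint w v hw2 hw12 hw7 hv2 hv12 hv7 this
  · push Not at h
    exact reach_of_tree i true h v h2 h12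

/-- If the pendant edge is the deleted one, the linking edge leads to the next hub, and `h` supplies
the way back. -/
theorem reach_hub_of_twelve (hF : F.Subsingleton) (i : ZMod k)
    (h : Sum.inl (i, 22) ∈ F → Reach F (i + 1, 7) (i, 7)) : Reach F (i, 12) (i, 7) := by
  by_cases h22 : Sum.inl (i, 22) ∈ F
  · have h1 : Sum.inr i ∉ F := fun h' => by simpa using hF h22 h'
    have h2 : Sum.inl (i + 1, 4) ∉ F := fun h' => by simpa using hF h22 h'
    exact ((reach_of_link h1).trans (reach_of_edge (by decide) h2)).trans (h h22)
  · exact (reach_of_edge (by decide) h22)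

theorem reach_hub_of_two (hF : F.Subsingleton) (i : ZMod k)
    (h : Sum.inl (i, 4) ∈ F → Reach F (i - 1, 7) (i, 7)) : Reach F (i, 2) (i, 7) := by
  by_cases h4 : Sum.inl (i, 4) ∈ F
  · have h1 : Sum.inr (i - 1) ∉ F := fun h' => by simpa using hF h4 h'
    have h2 : Sum.inl (i - 1, 22) ∉ F := fun h' => by simpa using hF h4 h'
    have h3 := reach_of_link h1
    rw [sub_add_cancel] at h3
    exact (h3.symm.trans (reach_of_edge (by decide) h2)).trans (h h4)
  · exact (reach_of_edge (by decide) h4)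

/-- The deletion of at most one edge breaks at most one of the paths between successive hubs. -/
theorem exists_reach_hub_succ (hF : F.Subsingleton) :
    ∃ i₀ : ZMod k, ∀ i, i ≠ i₀ → Reach F (i, 7) (i + 1, 7) := by
  let Broken : ZMod k → Prop := fun i =>
    Sum.inl (i, 22) ∈ F ∨ Sum.inr i ∈ F ∨ Sum.inl (i + 1, 4) ∈ F
  have hgood : ∀ i, ¬ Broken i → Reach F (i, 7) (i + 1, 7) := fun i hi => by
    simp only [Broken, not_or] at hi
    exact ((reach_of_edge (by decide) hi.1).trans (reach_of_link hi.2.1)).trans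
      (reach_of_edge (by decide) hi.2.2)
  have huniq : ∀ i j, Broken i → Broken j → i = j := by
    -- The three-edge paths between successive hubs are edge-disjoint for distinct indices.
    rintro i j (hi | hi | hi) (hj | hj | hj) <;> simpa using hF hi hj
  by_cases h : ∃ i, Broken i
  · obtain ⟨i₀, h₀⟩ := h
    exact ⟨i₀, fun i hi => hgood i fun hi' => hi (huniq i i₀ hi' h₀)⟩
  · push Not at h
    exact ⟨0, fun i _ => hgood i (h i)⟩

/-- A cycle with one gap is still a path: starting just after the broken step, at most `k - 1` steps
reach every hub. -/
theorem reach_hub [NeZero k] (hF : F.Subsingleton) (i j : ZMod k) :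
    Reach F (i, 7) (j, 7) := by
  obtain ⟨i₀, h₀⟩ := exists_reach_hub_succ hF
  have hstep : ∀ n : ℕ, n < k → Reach F (i₀ + 1, 7) (i₀ + 1 + n, 7) := by
    intro n
    induction n with
    | zero => intro _; rw [Nat.cast_zero, add_zero]; exact Relation.ReflTransGen.refl
    | succ m ih =>
      intro hm
      have hne : i₀ + 1 + (m : ZMod k) ≠ i₀ := by
        intro h
        have h1 : ((m + 1 : ℕ) : ZMod k) = 0 := by
          push_cast
          linear_combination h
        rw [ZMod.natCast_eq_zero_iff] at h1
        exact absurd (Nat.le_of_dvd (Nat.succ_pos m) h1) (by lia)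
      have h1 := (ih (by lia)).trans (h₀ _ hne)
      rwa [add_assoc (i₀ + 1), ← Nat.cast_succ] at h1
  have hall : ∀ j, Reach F (i₀ + 1, 7) (j, 7) := fun j => by
    have h1 := hstep (j - (i₀ + 1)).val (ZMod.val_lt _)
    rwa [ZMod.natCast_zmod_val, add_sub_cancel] at h1
  exact (hall i).symm.trans (hall j)

theorem connected_deleteEdges [NeZero k] (hF : F.Subsingleton) :
    ((baseMultigraph.circularArrangement 2 12 k).deleteEdges F).Connected := by
  have hub : ∀ p : ZMod k × Fin 13, Reach F p (p.1, 7) := by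
    rintro ⟨i, v⟩
    by_cases h2 : v = 2
    · rw [h2]; exact reach_hub_of_two hF i fun _ => reach_hub hF _ _
    · by_cases h12 : v = 12
      · rw [h12]; exact reach_hub_of_twelve hF i fun _ => reach_hub hF _ _
      · exact reach_hub_of_ne hF i v h2 h12
  refine ⟨⟨(0, 0), Set.mem_univ _⟩, fun p _ q _ => ?_⟩
  exact ((hub p).trans (reach_hub hF _ _)).trans (hub q).symm

end deleteEdges

/-! ### Small cuts, the two connectivities and the order -/

theorem circularArrangement_vertexSet (k : ℕ) :
    V(baseMultigraph.circularArrangement 2 12 k) = Set.univ := rfl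

theorem one_lt_encard_circularArrangement (k : ℕ) :
    1 < V(baseMultigraph.circularArrangement 2 12 k).encard := by
  rw [circularArrangement_vertexSet, Set.one_lt_encard_iff]
  exact ⟨(0, 0), (0, 1), Set.mem_univ _, Set.mem_univ _, by simp⟩

/-- The vertices of the copy with index `0` that the vertex `7` separates from the other copies. -/
def IsInner {k : ℕ} (p : ZMod k × Fin 13) : Prop :=
  p.1 = 0 ∧ p.2 ≠ 2 ∧ p.2 ≠ 7 ∧ p.2 ≠ 12

/-- This gives both upper bounds: edges 3 and 5 form an edge cut, and their common end 7 is a cut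
vertex. -/
theorem isInner_of_isLink {k : ℕ} {e : (ZMod k × Fin 23) ⊕ ZMod k} {p q : ZMod k × Fin 13}
    (h : (baseMultigraph.circularArrangement 2 12 k).IsLink e p q) (hp : IsInner p) :
    IsInner q ∨ q = (0, 7) ∧ (e = .inl (0, 3) ∨ e = .inl (0, 5)) := by
  obtain ⟨hp1, hp2, hp7, hp12⟩ := hp
  rcases e with ⟨i, e⟩ | i
  · obtain ⟨h1, h2, h3⟩ := h
    obtain rfl : i = 0 := h1.symm.trans hp1
    have key : ∀ e x, x ∈ baseEnds e → x ≠ 2 → x ≠ 7 → x ≠ 12 → ∀ y ∈ baseEnds e,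
        y ≠ 2 ∧ y ≠ 12 ∧ (y = 7 → e = 3 ∨ e = 5) := by
      decide +kernel
    have h3 : baseEnds e = s(p.2, q.2) := h3
    obtain ⟨k1, k2, k3⟩ := key e p.2 (by simp [h3]) hp2 hp7 hp12 q.2 (by simp [h3])
    by_cases h7 : q.2 = 7
    · refine Or.inr ⟨Prod.ext h2 h7, ?_⟩
      rcases k3 h7 with rfl | rfl <;> simp
    · exact Or.inl ⟨h2, k1, h7, k2⟩
  · exfalso
    rcases eq_or_eq_of_circularArrangement_inc_inr h.inc_left with rfl | rfl
    · exact hp12 rfl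
    · exact hp2 rfl

theorem circularArrangement_edgeConnectivity (k : ℕ) [NeZero k] :
    (baseMultigraph.circularArrangement 2 12 k).edgeConnectivity = 2 := by
  refine le_antisymm (iSup₂_le fun n hn => ?_) (le_iSup₂_of_le 2 ?_ le_rfl)
  · by_contra! hlt
    have hlt' : 2 < n := by exact_mod_cast hlt
    refine not_connected_of_closed IsInner ?_ (x := (0, 0)) (y := (0, 7)) (Set.mem_univ _)
      (Set.mem_univ _) (by simp [IsInner]) (by simp [IsInner])
      (hn.2 {.inl (0, 3), .inl (0, 5)} ?_ ?_)
    · rintro e p q ⟨h1, h2⟩ hp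
      rcases isInner_of_isLink h1 hp with h | ⟨-, h⟩
      · exact h
      · exact absurd h h2
    · rintro e (rfl | rfl)
      · exact IsLink.edge_mem (x := (0, 0)) (y := (0, 7)) ⟨rfl, rfl, rfl⟩
      · exact IsLink.edge_mem (x := (0, 5)) (y := (0, 7)) ⟨rfl, rfl, rfl⟩
    · refine lt_of_le_of_lt ?_ hlt
      refine (Set.encard_insert_le _ _).trans ?_
      rw [Set.encard_singleton, one_add_one_eq_two]
  · refine ⟨one_lt_encard_circularArrangement k, fun F _ hF => connected_deleteEdges ?_⟩
    rw [← Set.encard_le_one_iff_subsingleton]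
    exact Order.le_of_lt_add_one (by rwa [one_add_one_eq_two])

theorem circularArrangement_vertexConnectivity (k : ℕ) [NeZero k] :
    (baseMultigraph.circularArrangement 2 12 k).vertexConnectivity = 1 := by
  refine le_antisymm (iSup₂_le fun n hn => ?_) (le_iSup₂_of_le 1 ?_ (by simp))
  · by_contra! hlt
    refine not_connected_of_closed IsInner ?_ (x := (0, 0)) (y := (0, 2)) ?_
      ?_ (by simp [IsInner]) (by simp [IsInner])
      (hn.2 {(0, 7)} (Set.subset_univ _) (by rwa [Set.encard_singleton]))
    · intro e p q h hp
      rw [deleteVerts_isLink] at h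
      rcases isInner_of_isLink h.1 hp with h' | ⟨h', -⟩
      · exact h'
      · exact absurd h' h.2.2
    all_goals simp [vertexSet_deleteVerts, circularArrangement_vertexSet]
  · refine ⟨by exact_mod_cast one_lt_encard_circularArrangement k, fun X _ hX => ?_⟩
    obtain rfl : X = ∅ := by
      rw [← Set.encard_eq_zero]
      exact Order.lt_one_iff.1 (by exact_mod_cast hX)
    -- Connectedness of the whole graph is the case of no deleted edge.
    rw [deleteVerts_empty, ← deleteEdges_empty (G := circularArrangement _ _ _ _)]
    exact connected_deleteEdges Set.subsingleton_empty

theorem card_vertexSet_circularArrangement (k : ℕ) :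
    Nat.card V(baseMultigraph.circularArrangement 2 12 k) = k * 13 := by
  rw [circularArrangement_vertexSet, Nat.card_congr (Equiv.Set.univ _), Nat.card_prod]
  simp

end Graph

theorem mainTheorem8 :
    (Graph.baseMultigraph.HasCircularChromaticIndex (19 / 4) ∧
      ∀ x : Fin 13, Graph.baseMultigraph.degree x = 1 ↔ x = 2 ∨ x = 12) ∧
    (∀ k : ℕ, 2 ≤ k →
      (Graph.baseMultigraph.circularArrangement 2 12 k).vertexSet.Finite ∧
      (Graph.baseMultigraph.circularArrangement 2 12 k).edgeSet.Finite ∧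
      (Graph.baseMultigraph.circularArrangement 2 12 k).HasCircularChromaticIndex (4 + 3 / 4) ∧
      (Graph.baseMultigraph.circularArrangement 2 12 k).maxDegree = 4 ∧
      (Graph.baseMultigraph.circularArrangement 2 12 k).vertexConnectivity = 1 ∧
      (Graph.baseMultigraph.circularArrangement 2 12 k).edgeConnectivity = 2) ∧
    (∀ j k : ℕ, 2 ≤ j → 2 ≤ k →
      (Graph.baseMultigraph.circularArrangement 2 12 j).IsIsomorphic
        (Graph.baseMultigraph.circularArrangement 2 12 k) → j = k) := by
  refine ⟨⟨Graph.baseMultigraph_hasCircularChromaticIndex,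
    Graph.baseMultigraph_degree_eq_one_iff⟩, fun k hk => ?_, ?_⟩
  · have : NeZero k := ⟨by lia⟩
    refine ⟨Set.toFinite _, Set.toFinite _, ?_, Graph.circularArrangement_maxDegree k,
      Graph.circularArrangement_vertexConnectivity k,
      Graph.circularArrangement_edgeConnectivity k⟩
    rw [show (4 + 3 / 4 : ℝ) = 19 / 4 by norm_num]
    exact Graph.circularArrangement_hasCircularChromaticIndex k
  · rintro j k - - ⟨f, -⟩
    have h := Nat.card_congr f
    rw [Graph.card_vertexSet_circularArrangement, Graph.card_vertexSet_circularArrangement] at h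
    lia
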